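/- Let $\mathcal H$ be a complex Hilbert space with scalar product $\langle\cdot,\cdot\rangle_0$, and let $B_0$ be a bounded self-adjoint operator on $\mathcal H$. Let $(\Lambda_\eta)_{\eta\in[0,1]}$ be a family of bounded self-adjoint operators on $\mathcal H$ which is (real) bounded-holomorphic, i.e. $\eta\mapsto\Lambda_\eta$ is real-analytic on $[0,1]$ in operator norm, with $\Lambda_0=\mathrm{Id}$, and such that $\Lambda_{\eta_1}\le\Lambda_{\eta_2}$ (in the sense of self-adjoint operators) whenever $0\le\eta_1\le\eta_2\le1$. For $\eta\in[0,1]$ define the scalar product $\mathcal S_\eta(X,Y):=\langle X,\Lambda_\eta Y\rangle_0$ on $\mathcal H$, with norm $\|X\|_\eta:=\mathcal S_\eta(X,X)^{1/2}$, and the operator $B_\eta:=B_0\circ\Lambda_\eta$. Denote by $\|\cdot\|_{\mathcal L(\eta)}$ the operator norm on $\mathcal L(\mathcal H)$ when $\mathcal H$ carries the norm $\|\cdot\|_\eta$. Suppose that the point spectrum satisfies $\sigma_p(B_\eta)=\{0\}$ for all $\eta\in[0,1]$. Let $\mathcal H_{\mathrm{cont},\eta}$ be the orthogonal complement of $\mathrm{Ker}\,B_\eta$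 with respect to $\mathcal S_\eta$, and let $\Pi_{\mathrm{cont},\eta}$ be the $\mathcal S_\eta$-orthogonal projection of $\mathcal H$ onto $\mathcal H_{\mathrm{cont},\eta}$. Let $\sigma:[0,1]\to[0,1]$ be a continuous nondecreasing function with $\sigma(0)=0$ and $\sigma(1)=1$. Then for every compact operator $K$ on $\mathcal H$ and every fixed $T>0$, $$ \lim_{\varepsilon\to0^+}\left\|\frac1T\int_0^T e^{-i\frac t\varepsilon B_{\sigma(\varepsilon)}}\,\Lambda_{\sigma(\varepsilon)}^{-1}K\,\Pi_{\mathrm{cont},\sigma(\varepsilon)}\,e^{i\frac t\varepsilon B_{\sigma(\varepsilon)}}\,dt\right\|_{\mathcal L(\sigma(\varepsilon))}=0 . $$ -/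

import Mathlib

namespace RageParam

open Set Filter Topology

variable {H : Type*} [NormedAddCommGroup H] [InnerProductSpace ℂ H]

/-- The scalar product `S(x, y) = ⟨x, L y⟩` induced by an endomorphism `L`
(conjugate-linear in `x`, linear in `y`). -/
noncomputable def metricInner (L : H →L[ℂ] H) (x y : H) : ℂ :=
  inner ℂ x (L y)

/-- The norm `S(x, x)^(1/2)` of the scalar product induced by `L`. -/
noncomputable def metricNorm (L : H →L[ℂ] H) (x : H) : ℝ :=
  Real.sqrt (metricInner L x x).re

/-- The operator norm of `P` when `H` carries the scalar product induced by `L`. -/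
noncomputable def metricOpNorm (L P : H →L[ℂ] H) : ℝ :=
  sInf {c : ℝ | 0 ≤ c ∧ ∀ x, metricNorm L (P x) ≤ c * metricNorm L x}

/-- The orthogonal complement of `M` for the scalar product induced by `L`. -/
def metricOrthogonal (L : H →L[ℂ] H) (M : Submodule ℂ H) : Submodule ℂ H where
  carrier := {x | ∀ m ∈ M, metricInner L m x = 0}
  zero_mem' := by
    intro m _
    simp [metricInner]
  add_mem' := by
    intro x y hx hy m hm
    have h1 := hx m hm
    have h2 := hy m hm
    simp only [metricInner] at h1 h2 ⊢
    rw [map_add, inner_add_right, h1, h2, add_zero]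
  smul_mem' := by
    intro c x hx m hm
    have h1 := hx m hm
    simp only [metricInner] at h1 ⊢
    rw [map_smul, inner_smul_right, h1, mul_zero]

/-- `P` is the orthogonal projection onto `M` for the scalar product induced by `L`. -/
def IsMetricOrthProj (L : H →L[ℂ] H) (M : Submodule ℂ H) (P : H →L[ℂ] H) : Prop :=
  ∀ x, P x ∈ M ∧ x - P x ∈ metricOrthogonal L M

open Classical in
/-- The orthogonal projection onto `M` for the scalar product induced by `L`.  For `1 ≤ L` and `M`
closed it exists and is characterised by `metricOrthProj_spec` and `IsMetricOrthProj.unique`. -/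
noncomputable def metricOrthProj (L : H →L[ℂ] H) (M : Submodule ℂ H) : H →L[ℂ] H :=
  if h : ∃ P : H →L[ℂ] H, IsMetricOrthProj L M P then h.choose else 0

/-- The set of eigenvalues of `B`. -/
def pointSpectrum (B : H →L[ℂ] H) : Set ℂ :=
  {z | Module.End.HasEigenvalue (B : H →ₗ[ℂ] H) z}

/-- The orthogonal complement of `Ker (B₀ ∘ L)` for the scalar product induced by `L`. -/
def contSubspace (B₀ L : H →L[ℂ] H) : Submodule ℂ H :=
  metricOrthogonal L (B₀ ∘L L).ker

/-- The projection onto `contSubspace B₀ L`, orthogonal for the scalar product induced by `L`. -/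
noncomputable def contProj (B₀ L : H →L[ℂ] H) : H →L[ℂ] H :=
  metricOrthProj L (contSubspace B₀ L)

/-- `exp (i s B)`. -/
noncomputable def propagator (B : H →L[ℂ] H) (s : ℝ) : H →L[ℂ] H :=
  NormedSpace.exp ((Complex.I * (s : ℂ)) • B)

/-- With `B = B₀ ∘ L`, the time average
`(1/T) ∫_0^T exp(-i (t/ε) B) L⁻¹ K Π exp(i (t/ε) B) dt`, a Bochner integral in the space of bounded
operators, where `Π = contProj B₀ L`. -/
noncomputable def timeAverage (B₀ L K : H →L[ℂ] H) (T ε : ℝ) : H →L[ℂ] H :=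
  T⁻¹ • ∫ t in (0 : ℝ)..T,
    propagator (B₀ ∘L L) (-(t / ε)) ∘L (L.inverse ∘L K) ∘L contProj B₀ L ∘L
      propagator (B₀ ∘L L) (t / ε)

section Wellposed

theorem sq_norm_le_of_one_le {L : H →L[ℂ] H} (hL : 1 ≤ L) (x : H) :
    ‖x‖ ^ 2 ≤ (metricInner L x x).re := by
  have h := (ContinuousLinearMap.le_def _ _).1 hL
  have h2 := h.re_inner_nonneg_right x
  simp only [sub_apply, one_apply_eq_self, inner_sub_right,
    map_sub, sub_nonneg] at h2
  rw [inner_self_eq_norm_sq] at h2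
  exact h2

theorem norm_le_metricNorm {L : H →L[ℂ] H} (hL : 1 ≤ L) (x : H) : ‖x‖ ≤ metricNorm L x :=
  Real.le_sqrt_of_sq_le (sq_norm_le_of_one_le hL x)

theorem metricNorm_le (L : H →L[ℂ] H) (x : H) : metricNorm L x ≤ Real.sqrt ‖L‖ * ‖x‖ := by
  rw [← Real.sqrt_sq (norm_nonneg x), ← Real.sqrt_mul (norm_nonneg L)]
  refine Real.sqrt_le_sqrt ?_
  calc (metricInner L x x).re ≤ ‖metricInner L x x‖ := Complex.re_le_norm _
    _ ≤ ‖x‖ * ‖L x‖ := norm_inner_le_norm _ _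
    _ ≤ ‖x‖ * (‖L‖ * ‖x‖) := by gcongr; exact L.le_opNorm x
    _ = ‖L‖ * ‖x‖ ^ 2 := by ring

/-- The set whose infimum defines `metricOpNorm` is not empty. -/
theorem metricOpNorm_set_nonempty {L : H →L[ℂ] H} (hL : 1 ≤ L) (P : H →L[ℂ] H) :
    {c : ℝ | 0 ≤ c ∧ ∀ x, metricNorm L (P x) ≤ c * metricNorm L x}.Nonempty := by
  refine ⟨Real.sqrt ‖L‖ * ‖P‖, by positivity, fun x => ?_⟩
  calc metricNorm L (P x) ≤ Real.sqrt ‖L‖ * ‖P x‖ := metricNorm_le L _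
    _ ≤ Real.sqrt ‖L‖ * (‖P‖ * ‖x‖) := by gcongr; exact P.le_opNorm x
    _ ≤ Real.sqrt ‖L‖ * (‖P‖ * metricNorm L x) := by gcongr; exact norm_le_metricNorm hL x
    _ = Real.sqrt ‖L‖ * ‖P‖ * metricNorm L x := by ring

theorem isUnit_of_one_le [CompleteSpace H] {L : H →L[ℂ] H} (hL : 1 ≤ L) : IsUnit L := by
  refine ContinuousLinearMap.isUnit_of_forall_le_norm_inner_map L (c := 1) one_pos fun x => ?_
  rw [norm_inner_symm]
  have := (sq_norm_le_of_one_le hL x).trans (Complex.re_le_norm _)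
  simpa [metricInner] using this

/-- `L.inverse` is the two-sided inverse of `L`. -/
theorem inverse_comp_of_one_le [CompleteSpace H] {L : H →L[ℂ] H} (hL : 1 ≤ L) :
    L.inverse ∘L L = 1 ∧ L ∘L L.inverse = 1 := by
  rw [← ContinuousLinearMap.ringInverse_eq_inverse]
  exact ⟨Ring.inverse_mul_cancel _ (isUnit_of_one_le hL),
    Ring.mul_inverse_cancel _ (isUnit_of_one_le hL)⟩

theorem isClosed_metricOrthogonal (L : H →L[ℂ] H) (M : Submodule ℂ H) :
    IsClosed (metricOrthogonal L M : Set H) := by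
  have : (metricOrthogonal L M : Set H) = ⋂ m ∈ M, {x | inner ℂ m (L x) = 0} := by
    ext x
    simp [metricOrthogonal, metricInner]
  rw [this]
  exact isClosed_biInter fun m _ => isClosed_eq (by fun_prop) continuous_const

theorem IsMetricOrthProj.unique {L : H →L[ℂ] H} (hL : 1 ≤ L) {M : Submodule ℂ H}
    {P Q : H →L[ℂ] H} (hP : IsMetricOrthProj L M P) (hQ : IsMetricOrthProj L M Q) : P = Q := by
  ext x
  have hm : P x - Q x ∈ M := M.sub_mem (hP x).1 (hQ x).1
  have ho : P x - Q x ∈ metricOrthogonal L M := by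
    have := (metricOrthogonal L M).sub_mem (hQ x).2 (hP x).2
    simpa using this
  have h0 : metricInner L (P x - Q x) (P x - Q x) = 0 := ho _ hm
  have := sq_norm_le_of_one_le hL (P x - Q x)
  rw [h0] at this
  have h3 : ‖P x - Q x‖ = 0 := by
    have h4 : ‖P x - Q x‖ ^ 2 = 0 := le_antisymm (by simpa using this) (sq_nonneg _)
    exact pow_eq_zero_iff two_ne_zero |>.1 h4
  exact sub_eq_zero.1 (norm_eq_zero.1 h3)

theorem exists_isMetricOrthProj [CompleteSpace H] {L : H →L[ℂ] H} (hL : 1 ≤ L)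
    {M : Submodule ℂ H} (hM : IsClosed (M : Set H)) :
    ∃ P : H →L[ℂ] H, IsMetricOrthProj L M P := by
  have : CompleteSpace M := hM.completeSpace_coe
  let A : M →L[ℂ] M := M.orthogonalProjectionOnto ∘L L ∘L M.subtypeL
  have hA : IsUnit A := by
    refine ContinuousLinearMap.isUnit_of_forall_le_norm_inner_map A (c := 1) one_pos fun x => ?_
    rw [norm_inner_symm]
    have h1 := (sq_norm_le_of_one_le hL (x : H)).trans (Complex.re_le_norm _)
    have h2 : inner ℂ x (A x) = metricInner L (x : H) (x : H) := by
      simp [A, metricInner]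
    rw [h2]
    simpa using h1
  let A' : M →L[ℂ] M := Ring.inverse A
  have hA' : ∀ y, A (A' y) = y := fun y =>
    congrArg (fun f : M →L[ℂ] M => f y) (Ring.mul_inverse_cancel A hA)
  refine ⟨M.subtypeL ∘L A' ∘L M.orthogonalProjectionOnto ∘L L, fun x => ⟨by simp, ?_⟩⟩
  intro m hm
  have h1 := hA' (M.orthogonalProjectionOnto (L x))
  have h2 : M.orthogonalProjectionOnto
      (L (x - ((A' (M.orthogonalProjectionOnto (L x)) : M) : H))) = 0 := by
    rw [map_sub, map_sub, sub_eq_zero]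
    exact h1.symm
  have h3 := (Submodule.orthogonalProjectionOnto_eq_zero_iff).1 h2
  exact h3 m hm

theorem metricOrthProj_spec [CompleteSpace H] {L : H →L[ℂ] H} (hL : 1 ≤ L)
    {M : Submodule ℂ H} (hM : IsClosed (M : Set H)) :
    IsMetricOrthProj L M (metricOrthProj L M) := by
  have h := exists_isMetricOrthProj hL hM
  rw [metricOrthProj, dif_pos h]
  exact h.choose_spec

/-- `contProj B₀ L` is the orthogonal projection that it is meant to be. -/
theorem contProj_spec [CompleteSpace H] {L : H →L[ℂ] H} (hL : 1 ≤ L) (B₀ : H →L[ℂ] H) :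
    IsMetricOrthProj L (contSubspace B₀ L) (contProj B₀ L) :=
  metricOrthProj_spec hL (isClosed_metricOrthogonal _ _)

/-- The integrand of `timeAverage` is continuous in operator norm, so its integral exists. -/
theorem continuous_timeAverage_integrand [CompleteSpace H] (B₀ L K : H →L[ℂ] H) (ε : ℝ) :
    Continuous fun t : ℝ =>
      propagator (B₀ ∘L L) (-(t / ε)) ∘L (L.inverse ∘L K) ∘L contProj B₀ L ∘L
        propagator (B₀ ∘L L) (t / ε) := by
  have hexp : Continuous (propagator (B₀ ∘L L)) := by
    unfold propagator
    let _ : NormedAlgebra ℚ (H →L[ℂ] H) := NormedAlgebra.restrictScalars ℚ ℂ (H →L[ℂ] H)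
    exact NormedSpace.exp_continuous.comp (by fun_prop)
  have h1 : Continuous fun t : ℝ => propagator (B₀ ∘L L) (-(t / ε)) :=
    hexp.comp (by fun_prop)
  have h2 : Continuous fun t : ℝ => propagator (B₀ ∘L L) (t / ε) := hexp.comp (by fun_prop)
  exact h1.clm_comp (continuous_const.clm_comp (continuous_const.clm_comp h2))

end Wellposed

end RageParam

namespace RageParam

open Set Filter Topology MeasureTheory
open scoped Interval

variable {H : Type*} [NormedAddCommGroup H] [InnerProductSpace ℂ H]

/-! ### Spectral measures of a self-adjoint operator and their atoms -/

section SpectralMeasure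

variable [CompleteSpace H]

/-! After rescaling time, the quantity is an ergodic mean over `[0, T/ε]`, and `Λ (σ ε)` tends to
the identity in norm. No rate is needed: cutting the long interval into blocks of fixed length `N`
bounds its mean by the mean over `[0, N]` plus an error of order `N ε / T` (`mean_evolve_le`). The
constants stay bounded because `exp (i s B₀ L)` is unitary for the scalar product of `L`. For fixed
`N` the mean is norm continuous in the generator and the observable (`continuous_integral_evolve`),
so it tends to the mean for `B₀` and `K Π`. Here `Π` is the usual projection onto `(ker B₀)ᗮ`; the
projections for `L` have that same range and converge to it (`contSubspace_eq`,
`norm_contProj_sub_le`).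

For `B₀` this is the RAGE theorem (`meanNull_of_isCompactOperator`). Compactness reduces it to rank
one operators `x ↦ ⟨w, x⟩ u`, with `w` orthogonal to all eigenvectors. Multiplying the integral by
its adjoint leaves the function `⟨w, exp (i r B₀) w⟩`, the Fourier transform of a spectral measure
without atoms, whose mean vanishes by Wiener's lemma. The length `N` is chosen first, then `ε` tends
to zero. -/

theorem exists_spectralMeasure {A : H →L[ℂ] H} (hA : IsSelfAdjoint A) (w : H) :
    ∃ μ : Measure ℝ, IsFiniteMeasure μ ∧
      ∀ f : ℝ → ℝ, Continuous f → ∫ x, f x ∂μ = (inner ℂ w (cfc f A w)).re := by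
  have hc : CompactSpace (spectrum ℝ A) := isCompact_iff_compactSpace.1 (spectrum.isCompact A)
  -- Riesz–Markov applies to this functional, positive by the functional calculus. Since the
  -- spectrum is compact, every continuous function on it is admissible; the measure is then pushed
  -- forward to the line.
  let φ : CompactlySupportedContinuousMap (spectrum ℝ A) ℝ →ₗ[ℝ] ℝ :=
    { toFun := fun f => (inner ℂ w (cfcHom hA f.toContinuousMap w)).re
      map_add' := by
        intro f g
        have : (f + g).toContinuousMap = f.toContinuousMap + g.toContinuousMap := rfl
        rw [this, map_add, add_apply, inner_add_right, Complex.add_re]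
      map_smul' := by
        intro c f
        have : (c • f).toContinuousMap = c • f.toContinuousMap := rfl
        rw [this, map_smul, smul_apply, inner_smul_right_eq_smul]
        simp }
  let Φ : CompactlySupportedContinuousMap (spectrum ℝ A) ℝ →ₚ[ℝ] ℝ :=
    PositiveLinearMap.mk₀ φ (by
      intro f hf
      have h0 : 0 ≤ cfcHom hA f.toContinuousMap :=
        (cfcHom_nonneg_iff hA).2 fun x => hf x
      have h1 := (ContinuousLinearMap.nonneg_iff_isPositive _).1 h0
      exact h1.re_inner_nonneg_right w)
  let ν := RealRMK.rieszMeasure Φ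
  have hν : IsFiniteMeasure ν := inferInstance
  refine ⟨ν.map Subtype.val, inferInstance, fun f hf => ?_⟩
  rw [integral_map (by fun_prop) hf.aestronglyMeasurable]
  let g : CompactlySupportedContinuousMap (spectrum ℝ A) ℝ :=
    ⟨⟨fun x => f x, by fun_prop⟩, HasCompactSupport.of_compactSpace _⟩
  have h := RealRMK.integral_rieszMeasure Φ g
  refine h.trans ?_
  rw [cfc_apply f A hA hf.continuousOn]
  rfl

theorem inner_cfc_im_eq_zero (A : H →L[ℂ] H) (f : ℝ → ℝ) (w : H) :
    (inner ℂ w (cfc f A w)).im = 0 := by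
  have h : IsSelfAdjoint (cfc f A) := cfc_predicate f A
  exact h.isSymmetric.im_inner_self_apply w

/-- Euler's formula splits the exponential into real functions, the only ones that the spectral
measure is tested against. -/
theorem propagator_eq_cfc {A : H →L[ℂ] H} (hA : IsSelfAdjoint A) (s : ℝ) :
    propagator A s = cfc (fun x : ℝ => Real.cos (s * x)) A
      + Complex.I • cfc (fun x : ℝ => Real.sin (s * x)) A := by
  have hn : IsStarNormal A := hA.isStarNormal
  have h1 : propagator A s = cfc (fun z : ℂ => Complex.exp ((Complex.I * s) * z)) A := by
    rw [propagator]
    have h2 := CFC.complex_exp_eq_normedSpace_exp (a := (Complex.I * (s : ℂ)) • A)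
      (ha := (hn.smul _))
    rw [← h2, ← cfc_comp_smul (Complex.I * (s : ℂ)) Complex.exp A]
    simp
  rw [h1, cfc_real_eq_complex _ hA, cfc_real_eq_complex _ hA,
    ← cfc_smul Complex.I (fun z : ℂ => ((Real.sin (s * z.re) : ℝ) : ℂ)) A,
    ← cfc_add A (fun z : ℂ => ((Real.cos (s * z.re) : ℝ) : ℂ)) _]
  refine cfc_congr fun z hz => ?_
  have hz' : z = (z.re : ℂ) := hA.mem_spectrum_eq_re hz
  simp only [smul_eq_mul]
  rw [hz', Complex.ofReal_re, mul_assoc, mul_comm Complex.I (_ * _), Complex.exp_mul_I]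
  push_cast
  ring

theorem charFun_eq_inner_propagator {A : H →L[ℂ] H} (hA : IsSelfAdjoint A) {w : H}
    {μ : Measure ℝ} [IsFiniteMeasure μ]
    (hμ : ∀ f : ℝ → ℝ, Continuous f → ∫ x, f x ∂μ = (inner ℂ w (cfc f A w)).re) (s : ℝ) :
    charFun μ s = inner ℂ w (propagator A s w) := by
  have hre : ∀ f : ℝ → ℝ, Continuous f → ((∫ x, f x ∂μ : ℝ) : ℂ) = inner ℂ w (cfc f A w) := by
    intro f hf
    rw [hμ f hf]
    apply Complex.ext
    · simp
    · simp [inner_cfc_im_eq_zero]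
  have hcos : Integrable (fun x => Real.cos (s * x)) μ :=
    Integrable.of_bound (by fun_prop) 1 (ae_of_all _ fun x => Real.abs_cos_le_one _)
  have hsin : Integrable (fun x => Real.sin (s * x)) μ :=
    Integrable.of_bound (by fun_prop) 1 (ae_of_all _ fun x => Real.abs_sin_le_one _)
  rw [propagator_eq_cfc hA, add_apply, smul_apply, inner_add_right, inner_smul_right,
    ← hre _ (by fun_prop), ← hre _ (by fun_prop), charFun_apply_real, ← integral_complex_ofReal,
    ← integral_complex_ofReal, ← integral_const_mul, ← integral_add]
  · congr 1
    ext x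
    rw [← Complex.ofReal_mul, Complex.exp_mul_I]
    push_cast
    ring
  · exact hcos.ofReal
  · exact hsin.ofReal.const_mul _

/-- A tent `f` of height 1 at `l` and slope `c` dominates the point mass, and `∫ f² dμ = ‖f(A) w‖²`.
Splitting `w` into `(A - l) z` and a remainder, `f(x) |x - l| ≤ 1 / c` controls the first piece and
`f ≤ 1` the second. -/
theorem measure_singleton_le_sq {A : H →L[ℂ] H} (hA : IsSelfAdjoint A) {w : H}
    {μ : Measure ℝ} [IsFiniteMeasure μ]
    (hμ : ∀ f : ℝ → ℝ, Continuous f → ∫ x, f x ∂μ = (inner ℂ w (cfc f A w)).re)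
    (l : ℝ) (z : H) {c : ℝ} (hc : 0 < c) :
    μ.real {l} ≤ (‖z‖ / c + ‖w - (A - algebraMap ℝ (H →L[ℂ] H) l) z‖) ^ 2 := by
  set f : ℝ → ℝ := fun x => max 0 (1 - c * |x - l|) with hf
  have hfc : Continuous f := by fun_prop
  have hf0 : ∀ x, 0 ≤ f x := fun x => le_max_left _ _
  have hf1 : ∀ x, f x ≤ 1 := fun x => max_le zero_le_one (by
    have : 0 ≤ c * |x - l| := by positivity
    linarith)
  have hfa : IsSelfAdjoint (cfc f A) := cfc_predicate f A
  have h1 : ∫ x, f x * f x ∂μ = ‖cfc f A w‖ ^ 2 := by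
    rw [hμ _ (by fun_prop), cfc_mul f f A, mul_apply_eq_comp,
      ← hfa.isSymmetric.apply_clm, inner_self_eq_norm_sq_to_K]
    norm_cast
  have h2 : μ.real {l} ≤ ∫ x, f x * f x ∂μ := by
    rw [← integral_indicator_one (measurableSet_singleton l)]
    refine integral_mono ?_ ?_ fun x => ?_
    · exact (integrable_const (1 : ℝ)).indicator (measurableSet_singleton l)
    · refine Integrable.of_bound (by fun_prop) 1 (ae_of_all _ fun x => ?_)
      rw [Real.norm_of_nonneg (mul_nonneg (hf0 x) (hf0 x))]
      exact mul_le_one₀ (hf1 x) (hf0 x) (hf1 x)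
    · by_cases hx : x = l
      · simp [hx, hf]
      · simpa [hx] using mul_nonneg (hf0 x) (hf0 x)
  have h3 : ‖cfc f A * (A - algebraMap ℝ (H →L[ℂ] H) l)‖ ≤ 1 / c := by
    have : A - algebraMap ℝ (H →L[ℂ] H) l = cfc (fun x : ℝ => x - l) A := by
      rw [cfc_sub (fun x : ℝ => x) (fun _ => l) A, cfc_id' ℝ A, cfc_const l A]
    rw [this, ← cfc_mul f _ A]
    refine norm_cfc_le (by positivity) fun x _ => ?_
    rw [norm_mul, Real.norm_of_nonneg (hf0 x), Real.norm_eq_abs, hf, le_div_iff₀ hc]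
    simp only
    rcases le_total 0 (1 - c * |x - l|) with h | h
    · rw [max_eq_right h]
      nlinarith [sq_nonneg (c * |x - l|), sq_nonneg (c * |x - l| - 1)]
    · rw [max_eq_left h]
      simp
  have h4 : ‖cfc f A‖ ≤ 1 := norm_cfc_le zero_le_one fun x _ => by
    rw [Real.norm_of_nonneg (hf0 x)]; exact hf1 x
  have h5 : cfc f A w = (cfc f A * (A - algebraMap ℝ (H →L[ℂ] H) l)) z
      + cfc f A (w - (A - algebraMap ℝ (H →L[ℂ] H) l) z) := by
    rw [map_sub, mul_apply_eq_comp]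
    abel
  have h6 : ‖cfc f A w‖ ≤ ‖z‖ / c + ‖w - (A - algebraMap ℝ (H →L[ℂ] H) l) z‖ := by
    rw [h5]
    refine (norm_add_le _ _).trans (add_le_add ?_ ?_)
    · refine ((ContinuousLinearMap.le_opNorm _ _).trans
        (mul_le_mul_of_nonneg_right h3 (norm_nonneg _))).trans (le_of_eq (by ring))
    · refine ((ContinuousLinearMap.le_opNorm _ _).trans
        (mul_le_mul_of_nonneg_right h4 (norm_nonneg _))).trans (le_of_eq (one_mul _))
  calc μ.real {l} ≤ ‖cfc f A w‖ ^ 2 := h1 ▸ h2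
    _ ≤ _ := by gcongr

/-- The spectral measure has no atom at `l` when `w` is orthogonal to the eigenspace at `l`. -/
theorem measure_singleton_eq_zero {A : H →L[ℂ] H} (hA : IsSelfAdjoint A) {w : H}
    {μ : Measure ℝ} [IsFiniteMeasure μ]
    (hμ : ∀ f : ℝ → ℝ, Continuous f → ∫ x, f x ∂μ = (inner ℂ w (cfc f A w)).re)
    (l : ℝ) (hw : w ∈ (A - algebraMap ℝ (H →L[ℂ] H) l).kerᗮ) : μ {l} = 0 := by
  set D := A - algebraMap ℝ (H →L[ℂ] H) l with hD
  have hDs : IsSelfAdjoint D := hA.sub (IsSelfAdjoint.algebraMap _ (IsSelfAdjoint.all l))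
  have hcl : w ∈ closure (Set.range D) := by
    have h := ContinuousLinearMap.orthogonal_ker D
    rw [← ContinuousLinearMap.star_eq_adjoint, hDs.star_eq] at h
    rw [h] at hw
    exact hw
  rw [← measureReal_eq_zero_iff]
  refine le_antisymm (le_of_forall_pos_le_add fun δ hδ => ?_) measureReal_nonneg
  rw [zero_add]
  have hs : 0 < Real.sqrt δ := Real.sqrt_pos.2 hδ
  obtain ⟨_, ⟨z, rfl⟩, hz⟩ := Metric.mem_closure_iff.1 hcl (Real.sqrt δ / 2) (by positivity)
  rw [dist_eq_norm] at hz
  -- The slope is chosen after `z`, so that `‖z‖ / c ≤ √δ / 2`; the `+ 1` keeps it positive when `z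
  -- = 0`.
  have hc : 0 < 2 * (‖z‖ + 1) / Real.sqrt δ := by positivity
  refine (measure_singleton_le_sq hA hμ l z hc).trans ?_
  have h1 : ‖z‖ / (2 * (‖z‖ + 1) / Real.sqrt δ) ≤ Real.sqrt δ / 2 := by
    rw [div_div_eq_mul_div, div_le_div_iff₀ (by positivity) two_pos]
    nlinarith [norm_nonneg z]
  calc _ ≤ (Real.sqrt δ / 2 + Real.sqrt δ / 2) ^ 2 := by gcongr
    _ = δ := by rw [add_halves, Real.sq_sqrt hδ.le]

end SpectralMeasure

/-! ### Wiener's lemma for measures without atoms -/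

section Wiener

/-- By Fubini the mass at 0 is `∫ μ {x} dμ(x)`. -/
theorem measure_conv_neg_singleton_zero {μ : Measure ℝ} [IsFiniteMeasure μ]
    (hμ : ∀ x, μ {x} = 0) : (Measure.conv μ (μ.map (fun x => -1 * x))) {0} = 0 := by
  rw [Measure.conv, Measure.map_apply (by fun_prop) (measurableSet_singleton _),
    Measure.prod_apply ((measurableSet_singleton _).preimage (by fun_prop))]
  rw [lintegral_eq_zero_iff' (by
    refine Measurable.aemeasurable (measurable_measure_prodMk_left ?_)
    exact (measurableSet_singleton _).preimage (by fun_prop))]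
  refine ae_of_all _ fun x => ?_
  beta_reduce
  rw [Measure.map_apply (f := fun x : ℝ => -1 * x) (by fun_prop)]
  · refine Eq.trans (congrArg μ ?_) (hμ x)
    ext y
    simp [add_neg_eq_zero, eq_comm]
  · exact ((measurableSet_singleton (0 : ℝ)).preimage (by fun_prop)).preimage (by fun_prop)

/-- Wiener's lemma: the Fourier transform of a finite measure without atoms has mean zero. -/
theorem tendsto_mean_norm_charFun {μ : Measure ℝ} [IsFiniteMeasure μ] (hμ : ∀ x, μ {x} = 0) :
    Tendsto (fun N : ℝ => N⁻¹ * ∫ t in (-N)..N, ‖charFun μ t‖) atTop (𝓝 0) := by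
  set ν := Measure.conv μ (μ.map (fun x => -1 * x)) with hν
  have hsq : ∀ t, charFun ν t = ((‖charFun μ t‖ ^ 2 : ℝ) : ℂ) := by
    intro t
    rw [hν, charFun_conv, charFun_map_mul, neg_one_mul, charFun_neg, Complex.mul_conj,
      Complex.normSq_eq_norm_sq]
  -- `sinc (N x)` is bounded by 1 and tends to the indicator of `{0}`, so dominated convergence
  -- gives the limit `ν {0} = 0`.
  have hsinc : Tendsto (fun N : ℝ => ∫ x, Real.sinc (N * x) ∂ν) atTop (𝓝 0) := by
    have h0 : ∫ x, ({0} : Set ℝ).indicator (fun _ => (1 : ℝ)) x ∂ν = 0 := by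
      rw [integral_indicator_const _ (measurableSet_singleton _), measureReal_def,
        measure_conv_neg_singleton_zero hμ]
      simp
    rw [← h0]
    refine tendsto_integral_filter_of_dominated_convergence (fun _ => 1)
      (Eventually.of_forall fun N => by fun_prop) (Eventually.of_forall fun N =>
        ae_of_all _ fun x => by simpa using Real.abs_sinc_le_one _) (integrable_const _)
      (ae_of_all _ fun x => ?_)
    by_cases hx : x = 0
    · simp [hx]
    · simp only [mem_singleton_iff, hx, not_false_eq_true, indicator_of_notMem]
      have h1 : Tendsto (fun N : ℝ => (|x| * N)⁻¹) atTop (𝓝 0) :=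
        tendsto_inv_atTop_zero.comp (tendsto_id.const_mul_atTop (abs_pos.2 hx))
      refine squeeze_zero_norm' ?_ h1
      filter_upwards [eventually_gt_atTop 0] with N hN
      rw [Real.sinc_of_ne_zero (mul_ne_zero hN.ne' hx), norm_div, Real.norm_eq_abs, Real.norm_eq_abs,
        abs_mul N, abs_of_pos hN, mul_comm N |x|, div_eq_mul_inv]
      exact mul_le_of_le_one_left (inv_nonneg.2 (mul_nonneg (abs_nonneg x) hN.le))
        (Real.abs_sin_le_one _)
  have hint : ∀ N : ℝ, IntervalIntegrable (fun t => ‖charFun μ t‖) volume (-N) N := fun N =>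
    intervalIntegrable_charFun.norm
  have hint2 : ∀ N : ℝ, IntervalIntegrable (fun t => ‖charFun μ t‖ ^ 2) volume (-N) N := by
    intro N
    have h := (intervalIntegrable_charFun (μ := ν) (a := -N) (b := N)).norm
    refine h.congr ?_
    intro t _
    simp [hsq]
  -- The inequality `y ≤ δ + y² / δ` passes from the mean of the square, which is known, to the mean
  -- of the modulus.
  have hkey : ∀ δ : ℝ, 0 < δ → ∀ N : ℝ, 0 < N → N⁻¹ * ∫ t in (-N)..N, ‖charFun μ t‖
      ≤ 2 * δ + 2 / δ * ∫ x, Real.sinc (N * x) ∂ν := by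
    intro δ hδ N hN
    have h1 : ∫ t in (-N)..N, ‖charFun μ t‖ ^ 2 = 2 * N * ∫ x, Real.sinc (N * x) ∂ν := by
      have h := integral_charFun_Icc (μ := ν) hN
      simp_rw [hsq] at h
      rw [intervalIntegral.integral_ofReal] at h
      exact_mod_cast h
    have h2 : ∫ t in (-N)..N, ‖charFun μ t‖ ≤ ∫ t in (-N)..N, (δ + ‖charFun μ t‖ ^ 2 * δ⁻¹) := by
      refine intervalIntegral.integral_mono_on (by linarith) (hint N) ?_ fun t _ => ?_
      · exact intervalIntegrable_const.add ((hint2 N).mul_const _)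
      · rw [← div_eq_mul_inv, ← sub_nonneg]
        have : δ + ‖charFun μ t‖ ^ 2 / δ - ‖charFun μ t‖
            = ((‖charFun μ t‖ - δ) ^ 2 + δ * ‖charFun μ t‖) / δ := by field_simp; ring
        rw [this]
        positivity
    rw [intervalIntegral.integral_add intervalIntegrable_const ((hint2 N).mul_const _),
      intervalIntegral.integral_mul_const, h1, intervalIntegral.integral_const] at h2
    calc _ ≤ N⁻¹ * _ := mul_le_mul_of_nonneg_left h2 (by positivity)
      _ = _ := by
        simp only [smul_eq_mul]
        field_simp
        ring
  rw [Metric.tendsto_atTop']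
  intro e he
  have hev : ∀ᶠ N : ℝ in atTop, 2 / (e / 4) * ∫ x, Real.sinc (N * x) ∂ν < e / 2 := by
    have h := hsinc.const_mul (2 / (e / 4))
    rw [mul_zero] at h
    exact h.eventually_lt_const (by positivity)
  obtain ⟨N₀, h0⟩ := (hev.and (eventually_gt_atTop 0)).exists_forall_of_atTop
  refine ⟨N₀, fun N hN => ?_⟩
  obtain ⟨h1, h2⟩ := h0 N hN.le
  have h3 := hkey (e / 4) (by positivity) N h2
  have h4 : 0 ≤ N⁻¹ * ∫ t in (-N)..N, ‖charFun μ t‖ :=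
    mul_nonneg (by positivity)
      (intervalIntegral.integral_nonneg (by linarith) fun _ _ => norm_nonneg _)
  rw [Real.dist_eq, sub_zero, abs_of_nonneg h4]
  linarith

end Wiener

/-! ### Propagators, conjugated evolutions and ergodic means -/

section Propagator

variable [CompleteSpace H]

omit [CompleteSpace H] in
theorem propagator_zero (B : H →L[ℂ] H) : propagator B 0 = 1 := by
  simp [propagator, NormedSpace.exp_zero]

theorem propagator_add (B : H →L[ℂ] H) (s t : ℝ) :
    propagator B (s + t) = propagator B s * propagator B t := by
  let _ : NormedAlgebra ℚ (H →L[ℂ] H) := NormedAlgebra.restrictScalars ℚ ℂ (H →L[ℂ] H)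
  simp only [propagator]
  rw [← NormedSpace.exp_add_of_commute, ← add_smul]
  · push_cast
    ring_nf
  · exact ((Commute.refl B).smul_left _).smul_right _

theorem propagator_neg_mul (B : H →L[ℂ] H) (s : ℝ) : propagator B (-s) * propagator B s = 1 := by
  rw [← propagator_add, neg_add_cancel, propagator_zero]

theorem continuous_propagator : Continuous fun p : (H →L[ℂ] H) × ℝ => propagator p.1 p.2 := by
  unfold propagator
  let _ : NormedAlgebra ℚ (H →L[ℂ] H) := NormedAlgebra.restrictScalars ℚ ℂ (H →L[ℂ] H)
  exact NormedSpace.exp_continuous.comp (by fun_prop)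

theorem star_propagator (B : H →L[ℂ] H) (s : ℝ) :
    star (propagator B s) = propagator (star B) (-s) := by
  rw [propagator, NormedSpace.star_exp, propagator]
  simp [star_smul]

theorem norm_propagator_le_one {A : H →L[ℂ] H} (hA : IsSelfAdjoint A) (s : ℝ) :
    ‖propagator A s‖ ≤ 1 := by
  have h : ‖propagator A s‖ * ‖propagator A s‖ ≤ 1 := by
    rw [← CStarRing.norm_star_mul_self, star_propagator, hA.star_eq, propagator_neg_mul]
    exact ContinuousLinearMap.norm_id_le
  nlinarith [norm_nonneg (propagator A s)]

/-- The evolution `exp (-i t B) M exp (i t B)`. -/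
noncomputable def evolve (B M : H →L[ℂ] H) (t : ℝ) : H →L[ℂ] H :=
  propagator B (-t) * M * propagator B t

theorem continuous_evolve :
    Continuous fun p : ((H →L[ℂ] H) × (H →L[ℂ] H)) × ℝ => evolve p.1.1 p.1.2 p.2 := by
  unfold evolve
  have h1 : Continuous fun p : ((H →L[ℂ] H) × (H →L[ℂ] H)) × ℝ => propagator p.1.1 (-p.2) :=
    continuous_propagator.comp
      (f := fun p : ((H →L[ℂ] H) × (H →L[ℂ] H)) × ℝ => (p.1.1, -p.2)) (by fun_prop)
  have h2 : Continuous fun p : ((H →L[ℂ] H) × (H →L[ℂ] H)) × ℝ => propagator p.1.1 p.2 :=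
    continuous_propagator.comp
      (f := fun p : ((H →L[ℂ] H) × (H →L[ℂ] H)) × ℝ => (p.1.1, p.2)) (by fun_prop)
  exact (h1.mul (by fun_prop)).mul h2

theorem continuous_evolve_time (B M : H →L[ℂ] H) : Continuous (evolve B M) :=
  continuous_evolve.comp (f := fun t : ℝ => ((B, M), t)) (by fun_prop)

theorem intervalIntegrable_evolve (B M : H →L[ℂ] H) (a b : ℝ) :
    IntervalIntegrable (evolve B M) volume a b :=
  (continuous_evolve_time B M).intervalIntegrable a b

theorem evolve_add_time (B M : H →L[ℂ] H) (s t : ℝ) :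
    evolve B M (s + t) = propagator B (-t) * evolve B M s * propagator B t := by
  rw [evolve, evolve, propagator_add, neg_add_rev, propagator_add]
  noncomm_ring

theorem norm_evolve_le {B : H →L[ℂ] H} {C : ℝ} (hC : ∀ s, ‖propagator B s‖ ≤ C)
    (M : H →L[ℂ] H) (t : ℝ) : ‖evolve B M t‖ ≤ C ^ 2 * ‖M‖ := by
  have hC0 : 0 ≤ C := (norm_nonneg _).trans (hC 0)
  calc ‖evolve B M t‖ ≤ ‖propagator B (-t)‖ * ‖M‖ * ‖propagator B t‖ := norm_mul₃_le
    _ ≤ C * ‖M‖ * C := by gcongr <;> exact hC _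
    _ = C ^ 2 * ‖M‖ := by ring

theorem norm_integral_evolve_le {B : H →L[ℂ] H} {C : ℝ} (hC : ∀ s, ‖propagator B s‖ ≤ C)
    (M : H →L[ℂ] H) (a b : ℝ) : ‖∫ t in a..b, evolve B M t‖ ≤ C ^ 2 * ‖M‖ * |b - a| :=
  intervalIntegral.norm_integral_le_of_norm_le_const fun t _ => norm_evolve_le hC M t

/-- `M` has vanishing ergodic mean, in operator norm, under the evolution generated by `B`. -/
def MeanNull (B M : H →L[ℂ] H) : Prop :=
  Tendsto (fun N : ℝ => N⁻¹ * ‖∫ t in (0 : ℝ)..N, evolve B M t‖) atTop (𝓝 0)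

omit [CompleteSpace H] in
theorem MeanNull.zero (B : H →L[ℂ] H) : MeanNull B 0 := by
  simp [MeanNull, evolve]

theorem MeanNull.add {B M M' : H →L[ℂ] H} (h : MeanNull B M) (h' : MeanNull B M') :
    MeanNull B (M + M') := by
  have hs := Tendsto.add h h'
  rw [add_zero] at hs
  refine squeeze_zero' ?_ ?_ hs
  · filter_upwards [eventually_gt_atTop 0] with N hN
    positivity
  · filter_upwards [eventually_gt_atTop 0] with N hN
    have : evolve B (M + M') = fun t => evolve B M t + evolve B M' t := by
      ext1 t
      simp only [evolve]
      noncomm_ring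
    rw [this, intervalIntegral.integral_add (intervalIntegrable_evolve _ _ _ _)
      (intervalIntegrable_evolve _ _ _ _), ← mul_add]
    gcongr
    exact norm_add_le _ _

theorem MeanNull.sum {ι : Type*} {B : H →L[ℂ] H} (s : Finset ι) {M : ι → H →L[ℂ] H}
    (h : ∀ i ∈ s, MeanNull B (M i)) : MeanNull B (∑ i ∈ s, M i) :=
  Finset.sum_induction M (MeanNull B) (fun _ _ => MeanNull.add) (MeanNull.zero B) h

/-- Propagators of a self-adjoint operator are contractions, so replacing `M` by `M'` changes every
mean by at most `‖M - M'‖`, uniformly in `N`. -/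
theorem MeanNull.of_approx {A M : H →L[ℂ] H} (hA : IsSelfAdjoint A)
    (h : ∀ δ > 0, ∃ M', MeanNull A M' ∧ ‖M - M'‖ ≤ δ) : MeanNull A M := by
  rw [MeanNull, Metric.tendsto_nhds]
  intro δ hδ
  obtain ⟨M', hM', hd⟩ := h (δ / 2) (by positivity)
  filter_upwards [eventually_gt_atTop 0, hM'.eventually_lt_const (half_pos hδ)] with N hN h1
  have h2 : evolve A M = fun t => evolve A M' t + evolve A (M - M') t := by
    ext1 t
    simp only [evolve]
    noncomm_ring
  have h3 := norm_integral_evolve_le (norm_propagator_le_one hA) (M - M') 0 N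
  rw [one_pow, one_mul, sub_zero, abs_of_pos hN] at h3
  have h4 : N⁻¹ * ‖∫ t in (0 : ℝ)..N, evolve A (M - M') t‖ ≤ δ / 2 := by
    rw [inv_mul_le_iff₀ hN, mul_comm N]
    exact h3.trans (by gcongr)
  rw [Real.dist_eq, sub_zero, abs_of_nonneg (by positivity), h2,
    intervalIntegral.integral_add (intervalIntegrable_evolve _ _ _ _)
      (intervalIntegrable_evolve _ _ _ _)]
  calc _ ≤ N⁻¹ * (‖∫ t in (0 : ℝ)..N, evolve A M' t‖
        + ‖∫ t in (0 : ℝ)..N, evolve A (M - M') t‖) := by gcongr; exact norm_add_le _ _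
    _ < δ := by rw [mul_add]; linarith

end Propagator

/-! ### The RAGE theorem in operator norm -/

section Rage

variable [CompleteSpace H]

/-- In the product the two inner propagators merge, and `M exp (i r A) M*` is the scalar `⟨w, exp (i
r A) w⟩` times the rank one operator of `u`; only `r = s - t` matters. -/
theorem norm_evolve_mul_star_evolve_le {A : H →L[ℂ] H} (hA : IsSelfAdjoint A) (u w : H)
    (s t : ℝ) :
    ‖evolve A (InnerProductSpace.rankOne ℂ u w) s
        * star (evolve A (InnerProductSpace.rankOne ℂ u w) t)‖
      ≤ ‖u‖ ^ 2 * ‖inner ℂ w (propagator A (s - t) w)‖ := by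
  set M := InnerProductSpace.rankOne ℂ u w with hM
  have h1 : evolve A M s * star (evolve A M t)
      = propagator A (-s) * (M * propagator A (s - t) * star M) * propagator A t := by
    rw [evolve, evolve, star_mul, star_mul, star_propagator, star_propagator, hA.star_eq,
      sub_eq_add_neg, propagator_add, neg_neg]
    noncomm_ring
  have h2 : M * propagator A (s - t) * star M
      = inner ℂ w (propagator A (s - t) w) • InnerProductSpace.rankOne ℂ u u := by
    ext x
    rw [ContinuousLinearMap.star_eq_adjoint, hM, InnerProductSpace.adjoint_rankOne]
    simp [smul_smul, mul_comm]
  rw [h1, h2]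
  calc _ ≤ ‖propagator A (-s)‖ * _ * ‖propagator A t‖ := norm_mul₃_le
    _ ≤ 1 * ‖inner ℂ w (propagator A (s - t) w) • InnerProductSpace.rankOne ℂ u u‖ * 1 := by
      gcongr <;> exact norm_propagator_le_one hA _
    _ = _ := by
      rw [norm_smul, InnerProductSpace.norm_rankOne]
      ring

/-- By the C*-identity `‖J‖² = ‖J J*‖`, and `J J*` is a double integral. For each `t` in `(0, N]`
the difference `s - t` stays in `[-N, N]`; integrating over `t` gives the factor `N`. -/
theorem norm_integral_evolve_rankOne_sq_le {A : H →L[ℂ] H} (hA : IsSelfAdjoint A) (u w : H)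
    {N : ℝ} (hN : 0 ≤ N) :
    ‖∫ t in (0 : ℝ)..N, evolve A (InnerProductSpace.rankOne ℂ u w) t‖ ^ 2
      ≤ ‖u‖ ^ 2 * (∫ r in (-N)..N, ‖inner ℂ w (propagator A r w)‖) * N := by
  set F := evolve A (InnerProductSpace.rankOne ℂ u w) with hF
  have hFi : ∀ a b, IntervalIntegrable F volume a b := intervalIntegrable_evolve _ _
  have hFc : Continuous F := continuous_evolve_time _ _
  set J := ∫ t in (0 : ℝ)..N, F t with hJ
  have hc : Continuous fun r : ℝ => ‖inner ℂ w (propagator A r w)‖ := by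
    have h : Continuous fun r : ℝ => propagator A r :=
      continuous_propagator.comp (f := fun r : ℝ => (A, r)) (by fun_prop)
    fun_prop
  have h1 : J * star J = ∫ t in (0 : ℝ)..N, J * star (F t) := by
    have hs : star J = ∫ t in (0 : ℝ)..N, star (F t) :=
      ((starL' ℝ : (H →L[ℂ] H) ≃L[ℝ] (H →L[ℂ] H)).toContinuousLinearMap.intervalIntegral_comp_comm
        (hFi 0 N)).symm
    rw [hs]
    exact ((ContinuousLinearMap.mul ℝ (H →L[ℂ] H) J).intervalIntegral_comp_comm
      (hFc.star.intervalIntegrable 0 N)).symm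
  have h2 : ∀ t ∈ Ι (0 : ℝ) N, ‖J * star (F t)‖
      ≤ ‖u‖ ^ 2 * ∫ r in (-N)..N, ‖inner ℂ w (propagator A r w)‖ := by
    intro t ht
    rw [uIoc_of_le hN] at ht
    have hmul : J * star (F t) = ∫ s in (0 : ℝ)..N, F s * star (F t) :=
      (((ContinuousLinearMap.mul ℝ (H →L[ℂ] H)).flip (star (F t))).intervalIntegral_comp_comm
        (hFi 0 N)).symm
    rw [hmul]
    calc _ ≤ ∫ s in (0 : ℝ)..N, ‖u‖ ^ 2 * ‖inner ℂ w (propagator A (s - t) w)‖ := by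
          refine intervalIntegral.norm_integral_le_of_norm_le hN
            (Eventually.of_forall fun s _ => norm_evolve_mul_star_evolve_le hA u w s t) ?_
          exact (continuous_const.mul (hc.comp (continuous_sub_right t))).intervalIntegrable _ _
      _ = ‖u‖ ^ 2 * ∫ r in (0 - t)..(N - t), ‖inner ℂ w (propagator A r w)‖ := by
          rw [intervalIntegral.integral_const_mul,
            intervalIntegral.integral_comp_sub_right (fun r => ‖inner ℂ w (propagator A r w)‖)]
      _ ≤ _ := by
          gcongr
          exact intervalIntegral.integral_mono_interval (by linarith [ht.2]) (by linarith)
            (by linarith [ht.1]) (ae_of_all _ fun _ => norm_nonneg _) (hc.intervalIntegrable _ _)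
  have h3 := intervalIntegral.norm_integral_le_of_norm_le_const h2
  rw [← h1, CStarRing.norm_self_mul_star, sub_zero, abs_of_nonneg hN] at h3
  rw [pow_two]
  exact h3

theorem meanNull_rankOne {A : H →L[ℂ] H} (hA : IsSelfAdjoint A) (u : H) {w : H}
    (hw : ∀ l : ℝ, w ∈ (A - algebraMap ℝ (H →L[ℂ] H) l).kerᗮ) :
    MeanNull A (InnerProductSpace.rankOne ℂ u w) := by
  obtain ⟨μ, hfin, hμ⟩ := exists_spectralMeasure hA w
  have h1 := tendsto_mean_norm_charFun fun l => measure_singleton_eq_zero hA hμ l (hw l)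
  simp_rw [charFun_eq_inner_propagator hA hμ] at h1
  have h2 := (h1.const_mul (‖u‖ ^ 2)).sqrt
  rw [mul_zero, Real.sqrt_zero] at h2
  refine squeeze_zero' ?_ ?_ h2
  · filter_upwards [eventually_gt_atTop 0] with N hN
    positivity
  · filter_upwards [eventually_gt_atTop 0] with N hN
    refine Real.le_sqrt_of_sq_le ?_
    rw [mul_pow]
    calc _ ≤ N⁻¹ ^ 2 * _ :=
          mul_le_mul_of_nonneg_left (norm_integral_evolve_rankOne_sq_le hA u w hN.le) (by positivity)
      _ = _ := by field_simp

omit [CompleteSpace H] in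
-- `F` is spanned by a finite `δ`-net of the image of the unit ball, and the projection onto `F` is
-- at least as close as any point of the net.
theorem exists_finiteDimensional_norm_sub_le {K : H →L[ℂ] H} (hK : IsCompactOperator K) {δ : ℝ}
    (hδ : 0 < δ) : ∃ (F : Submodule ℂ H) (_ : FiniteDimensional ℂ F),
      ‖K - F.starProjection ∘L K‖ ≤ δ := by
  have htb : TotallyBounded (K '' Metric.closedBall 0 1) :=
    (IsCompactOperator.isCompact_closure_image_closedBall (f := (K : H →ₗ[ℂ] H))
      hK 1).totallyBounded.subset subset_closure
  obtain ⟨t, ht, hcov⟩ := Metric.totallyBounded_iff.1 htb δ hδ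
  have hfd : FiniteDimensional ℂ (Submodule.span ℂ t) := FiniteDimensional.span_of_finite ℂ ht
  refine ⟨Submodule.span ℂ t, hfd, ?_⟩
  refine ContinuousLinearMap.opNorm_le_of_unit_norm hδ.le fun x hx => ?_
  have hx1 : K x ∈ K '' Metric.closedBall 0 1 := ⟨x, by simp [hx], rfl⟩
  obtain ⟨y, hy, hxy⟩ := mem_iUnion₂.1 (hcov hx1)
  rw [sub_apply, ContinuousLinearMap.comp_apply, Submodule.starProjection_minimal]
  refine (ciInf_le ⟨0, ?_⟩ (⟨y, Submodule.subset_span hy⟩ : Submodule.span ℂ t)).trans ?_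
  · rintro _ ⟨z, rfl⟩
    exact norm_nonneg _
  · exact (mem_ball_iff_norm.1 hxy).le

theorem meanNull_of_isCompactOperator {A K P : H →L[ℂ] H} (hA : IsSelfAdjoint A)
    (hK : IsCompactOperator K) (hP : IsSelfAdjoint P) (hP1 : ‖P‖ ≤ 1)
    (hw : ∀ x, ∀ l : ℝ, P x ∈ (A - algebraMap ℝ (H →L[ℂ] H) l).kerᗮ) :
    MeanNull A (K * P) := by
  refine MeanNull.of_approx hA fun δ hδ => ?_
  obtain ⟨F, hF, hd⟩ := exists_finiteDimensional_norm_sub_le hK hδ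
  refine ⟨F.starProjection * K * P, ?_, ?_⟩
  · let b := stdOrthonormalBasis ℂ F
    -- Expanding in an orthonormal basis of `F` and moving `K` and `P` to the other side puts each
    -- functional's vector in the range of `P`, hence orthogonal to all eigenvectors.
    have : F.starProjection * K * P
        = ∑ i, InnerProductSpace.rankOne ℂ (b i : H) (P (star K (b i))) := by
      ext x
      simp only [mul_apply_eq_comp, sum_apply, InnerProductSpace.rankOne_apply]
      rw [Submodule.starProjection_apply, b.orthogonalProjectionOnto_apply_eq_sum]
      simp only [Submodule.coe_sum, Submodule.coe_smul]
      refine Finset.sum_congr rfl fun i _ => ?_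
      rw [ContinuousLinearMap.star_eq_adjoint, hP.isSymmetric.apply_clm,
        ContinuousLinearMap.adjoint_inner_left]
    rw [this]
    exact MeanNull.sum _ fun i _ => meanNull_rankOne hA _ (hw _)
  · have : K * P - F.starProjection * K * P = (K - F.starProjection ∘L K) * P := by
      rw [sub_mul]; rfl
    rw [this]
    calc _ ≤ ‖K - F.starProjection ∘L K‖ * ‖P‖ := norm_mul_le _ _
      _ ≤ δ * 1 := by gcongr
      _ = δ := mul_one δ

end Rage

/-! ### Changing the scalar product: unitarity and projections -/

section Perturbation

variable [CompleteSpace H]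

/-- `L` intertwines `B₀ L` with its adjoint `L B₀`, so the two exponentials cancel: the propagator
preserves the scalar product of `L`. -/
theorem star_propagator_mul_mul {B₀ L : H →L[ℂ] H} (hB₀ : IsSelfAdjoint B₀)
    (hL : IsSelfAdjoint L) (s : ℝ) :
    star (propagator (B₀ ∘L L) s) * (L * propagator (B₀ ∘L L) s) = L := by
  have h1 : L * propagator (B₀ * L) s = propagator (L * B₀) s * L := by
    let _ : NormedAlgebra ℚ (H →L[ℂ] H) := NormedAlgebra.restrictScalars ℚ ℂ (H →L[ℂ] H)
    have h : SemiconjBy L ((Complex.I * (s : ℂ)) • (B₀ * L)) ((Complex.I * (s : ℂ)) • (L * B₀)) := by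
      rw [SemiconjBy, mul_smul_comm, smul_mul_assoc, mul_assoc]
    exact h.exp_right
  change star (propagator (B₀ * L) s) * (L * propagator (B₀ * L) s) = L
  rw [h1, star_propagator, star_mul, hB₀.star_eq, hL.star_eq, ← mul_assoc, propagator_neg_mul,
    one_mul]

theorem metricNorm_propagator {B₀ L : H →L[ℂ] H} (hB₀ : IsSelfAdjoint B₀)
    (hL : IsSelfAdjoint L) (s : ℝ) (x : H) :
    metricNorm L (propagator (B₀ ∘L L) s x) = metricNorm L x := by
  have h : metricInner L (propagator (B₀ ∘L L) s x) (propagator (B₀ ∘L L) s x)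
      = metricInner L x x := by
    rw [metricInner, ← ContinuousLinearMap.adjoint_inner_right,
      ← ContinuousLinearMap.star_eq_adjoint, metricInner]
    congr 1
    exact congrArg (fun f : H →L[ℂ] H => f x) (star_propagator_mul_mul hB₀ hL s)
  rw [metricNorm, h, metricNorm]

theorem norm_propagator_le_sqrt {B₀ L : H →L[ℂ] H} (hB₀ : IsSelfAdjoint B₀)
    (hL : IsSelfAdjoint L) (h1 : 1 ≤ L) (s : ℝ) : ‖propagator (B₀ ∘L L) s‖ ≤ Real.sqrt ‖L‖ :=
  ContinuousLinearMap.opNorm_le_bound _ (Real.sqrt_nonneg _) fun x =>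
    (norm_le_metricNorm h1 _).trans
      ((metricNorm_propagator hB₀ hL s x).le.trans (metricNorm_le L x))

/-- `L` maps `ker (B₀ L)` onto `ker B₀`, which turns orthogonality for `L` into the usual one. The
range of the projection thus does not depend on `L`. -/
theorem contSubspace_eq {L : H →L[ℂ] H} (B₀ : H →L[ℂ] H) (hL : IsSelfAdjoint L) (h1 : 1 ≤ L) :
    contSubspace B₀ L = B₀.kerᗮ := by
  have hinv : ∀ m, L (L.inverse m) = m := fun m =>
    congrArg (fun f : H →L[ℂ] H => f m) (inverse_comp_of_one_le h1).2
  ext x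
  rw [Submodule.mem_orthogonal]
  constructor
  · intro hx m hm
    have h := hx (L.inverse m) (by
      simp only [LinearMap.mem_ker, ContinuousLinearMap.coe_coe, ContinuousLinearMap.comp_apply,
        hinv] at hm ⊢
      exact hm)
    rwa [metricInner, ← hL.isSymmetric.apply_clm, hinv] at h
  · intro hx m hm
    rw [metricInner, ← hL.isSymmetric.apply_clm]
    exact hx _ hm

theorem norm_contProj_sub_le {L : H →L[ℂ] H} (B₀ : H →L[ℂ] H) (hL : IsSelfAdjoint L)
    (h1 : 1 ≤ L) : ‖contProj B₀ L - B₀.kerᗮ.starProjection‖ ≤ ‖L - 1‖ := by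
  have hspec := contProj_spec h1 B₀
  rw [contSubspace_eq B₀ hL h1] at hspec
  refine ContinuousLinearMap.opNorm_le_bound _ (norm_nonneg _) fun x => ?_
  set P := B₀.kerᗮ.starProjection with hP
  set d := contProj B₀ L x - P x with hd
  have hdV : d ∈ B₀.kerᗮ := Submodule.sub_mem _ (hspec x).1 (Submodule.starProjection_apply_mem _ x)
  have e1 : inner ℂ d (L (x - contProj B₀ L x)) = 0 := (hspec x).2 d hdV
  have e2 : inner ℂ d (x - P x) = 0 :=
    Submodule.inner_right_of_mem_orthogonal hdV (Submodule.sub_starProjection_mem_orthogonal x)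
  -- Both projections have the same range, which contains `d`; the two orthogonality relations
  -- remove everything but the defect `L - 1`.
  have e3 : metricInner L d d = inner ℂ d ((L - 1) (x - P x)) := by
    have : L d = (L - 1) (x - P x) + (x - P x) - L (x - contProj B₀ L x) := by
      simp only [hd, sub_apply, one_apply_eq_self, map_sub]
      abel
    rw [metricInner, this, inner_sub_right, inner_add_right, e1, e2, add_zero, sub_zero]
  have e4 : ‖x - P x‖ ≤ ‖x‖ := by
    have : x - P x = (B₀.kerᗮ)ᗮ.starProjection x := by
      rw [Submodule.starProjection_orthogonal']; rfl
    rw [this]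
    exact Submodule.norm_starProjection_apply_le _ x
  have e5 : ‖d‖ ^ 2 ≤ ‖d‖ * (‖L - 1‖ * ‖x‖) := by
    refine (sq_norm_le_of_one_le h1 d).trans ?_
    rw [e3]
    refine (Complex.re_le_norm _).trans ((norm_inner_le_norm _ _).trans ?_)
    gcongr
    exact ((L - 1).le_opNorm _).trans (by gcongr)
  change ‖d‖ ≤ _
  rcases eq_or_lt_of_le (norm_nonneg d) with h | h
  · rw [← h]; positivity
  · rw [pow_two] at e5
    exact le_of_mul_le_mul_left e5 h

omit [CompleteSpace H] in
theorem metricOpNorm_nonneg (L P : H →L[ℂ] H) : 0 ≤ metricOpNorm L P :=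
  Real.sInf_nonneg fun _ h => h.1

omit [CompleteSpace H] in
theorem metricOpNorm_le {L : H →L[ℂ] H} (h1 : 1 ≤ L) (P : H →L[ℂ] H) :
    metricOpNorm L P ≤ Real.sqrt ‖L‖ * ‖P‖ := by
  refine csInf_le ⟨0, fun _ h => h.1⟩ ⟨by positivity, fun x => ?_⟩
  calc metricNorm L (P x) ≤ Real.sqrt ‖L‖ * ‖P x‖ := metricNorm_le L _
    _ ≤ Real.sqrt ‖L‖ * (‖P‖ * metricNorm L x) := by
      gcongr
      exact (P.le_opNorm x).trans (by gcongr; exact norm_le_metricNorm h1 x)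
    _ = Real.sqrt ‖L‖ * ‖P‖ * metricNorm L x := by ring

end Perturbation

/-! ### From fixed time to long time, and the limit -/

section LongTime

variable [CompleteSpace H]

theorem integral_evolve_shift (B M : H →L[ℂ] H) (a N : ℝ) :
    ∫ t in a..(a + N), evolve B M t
      = propagator B (-a) * (∫ t in (0 : ℝ)..N, evolve B M t) * propagator B a := by
  have h := intervalIntegral.integral_comp_add_right (a := 0) (b := N) (evolve B M) a
  rw [zero_add, add_comm N] at h
  rw [← h]
  simp_rw [evolve_add_time]
  exact (((ContinuousLinearMap.mul ℝ (H →L[ℂ] H)).flip (propagator B a)).comp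
    (ContinuousLinearMap.mul ℝ (H →L[ℂ] H) (propagator B (-a)))).intervalIntegral_comp_comm
      (intervalIntegrable_evolve B M 0 N)

/-- Each block of length `N` is the first one conjugated by propagators, at the cost of one factor
`C ^ 2` that does not accumulate. -/
theorem norm_integral_evolve_mul_le {B : H →L[ℂ] H} {C : ℝ} (hC : ∀ s, ‖propagator B s‖ ≤ C)
    (M : H →L[ℂ] H) (N : ℝ) (n : ℕ) :
    ‖∫ t in (0 : ℝ)..(n * N), evolve B M t‖
      ≤ n * (C ^ 2 * ‖∫ t in (0 : ℝ)..N, evolve B M t‖) := by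
  have hC0 : 0 ≤ C := (norm_nonneg _).trans (hC 0)
  induction n with
  | zero => simp
  | succ n ih =>
    have h1 : ((n + 1 : ℕ) : ℝ) * N = n * N + N := by push_cast; ring
    rw [h1, ← intervalIntegral.integral_add_adjacent_intervals
      (intervalIntegrable_evolve B M 0 (n * N)) (intervalIntegrable_evolve B M _ _),
      integral_evolve_shift]
    refine (norm_add_le _ _).trans ?_
    push_cast
    rw [add_mul, one_mul]
    refine add_le_add ih ?_
    calc _ ≤ ‖propagator B (-(n * N))‖ * ‖∫ t in (0 : ℝ)..N, evolve B M t‖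
          * ‖propagator B (n * N)‖ := norm_mul₃_le
      _ ≤ C * ‖∫ t in (0 : ℝ)..N, evolve B M t‖ * C := by gcongr <;> exact hC _
      _ = _ := by ring

/-- A mean over a long time is controlled by the mean over any shorter time. -/
theorem mean_evolve_le {B : H →L[ℂ] H} {C : ℝ} (hC : ∀ s, ‖propagator B s‖ ≤ C)
    (M : H →L[ℂ] H) {N τ : ℝ} (hN : 0 < N) (hτ : 0 < τ) :
    τ⁻¹ * ‖∫ t in (0 : ℝ)..τ, evolve B M t‖
      ≤ C ^ 2 * (N⁻¹ * ‖∫ t in (0 : ℝ)..N, evolve B M t‖) + C ^ 2 * ‖M‖ * N * τ⁻¹ := by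
  -- There are `n` whole blocks, and a remainder of length at most `N` that is bounded trivially.
  set n := ⌊τ / N⌋₊ with hn
  have h1 : (n : ℝ) ≤ τ / N := Nat.floor_le (by positivity)
  have h2 : τ / N < n + 1 := Nat.lt_floor_add_one _
  have h3 : |τ - n * N| ≤ N := by
    rw [le_div_iff₀ hN] at h1
    rw [div_lt_iff₀ hN] at h2
    rw [abs_of_nonneg (by linarith)]
    linarith
  have h4 := norm_integral_evolve_mul_le hC M N n
  have h5 := norm_integral_evolve_le hC M (n * N) τ
  have h6 : ‖∫ t in (0 : ℝ)..τ, evolve B M t‖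
      ≤ τ / N * (C ^ 2 * ‖∫ t in (0 : ℝ)..N, evolve B M t‖) + C ^ 2 * ‖M‖ * N := by
    rw [← intervalIntegral.integral_add_adjacent_intervals
      (intervalIntegrable_evolve B M 0 (n * N)) (intervalIntegrable_evolve B M _ _)]
    refine (norm_add_le _ _).trans (add_le_add (h4.trans ?_) (h5.trans ?_))
    · gcongr
    · gcongr
  calc _ ≤ τ⁻¹ * _ := mul_le_mul_of_nonneg_left h6 (by positivity)
    _ = _ := by field_simp

omit [CompleteSpace H] in
theorem timeAverage_eq (B₀ L K : H →L[ℂ] H) (T : ℝ) {ε : ℝ} (hε : ε ≠ 0) :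
    timeAverage B₀ L K T ε = (T / ε)⁻¹ •
      ∫ t in (0 : ℝ)..(T / ε), evolve (B₀ ∘L L) (L.inverse * K * contProj B₀ L) t := by
  have h : timeAverage B₀ L K T ε = T⁻¹ • ∫ t in (0 : ℝ)..T,
      evolve (B₀ ∘L L) (L.inverse * K * contProj B₀ L) (t / ε) := rfl
  rw [h, intervalIntegral.integral_comp_div _ hε, zero_div, smul_smul, inv_div, inv_mul_eq_div]

theorem norm_timeAverage_le {B₀ L : H →L[ℂ] H} (hB₀ : IsSelfAdjoint B₀) (hL : IsSelfAdjoint L)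
    (h1 : 1 ≤ L) (K : H →L[ℂ] H) {T ε N : ℝ} (hT : 0 < T) (hε : 0 < ε) (hN : 0 < N) :
    ‖timeAverage B₀ L K T ε‖
      ≤ ‖L‖ * (N⁻¹ * ‖∫ t in (0 : ℝ)..N,
          evolve (B₀ ∘L L) (L.inverse * K * contProj B₀ L) t‖)
        + ‖L‖ * ‖L.inverse * K * contProj B₀ L‖ * N * (ε / T) := by
  have h := mean_evolve_le (norm_propagator_le_sqrt hB₀ hL h1) (L.inverse * K * contProj B₀ L)
    hN (div_pos hT hε)
  rw [Real.sq_sqrt (norm_nonneg L), inv_div] at h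
  rw [timeAverage_eq _ _ _ _ hε.ne', norm_smul, inv_div, Real.norm_of_nonneg (by positivity)]
  exact h

theorem continuous_integral_evolve (N : ℝ) :
    Continuous fun p : (H →L[ℂ] H) × (H →L[ℂ] H) => ∫ t in (0 : ℝ)..N, evolve p.1 p.2 t :=
  intervalIntegral.continuous_parametric_intervalIntegral_of_continuous' continuous_evolve 0 N

theorem tendsto_integral_evolve {ι : Type*} {l : Filter ι} {B M : ι → H →L[ℂ] H}
    {B' M' : H →L[ℂ] H} (hB : Tendsto B l (𝓝 B')) (hM : Tendsto M l (𝓝 M')) (N : ℝ) :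
    Tendsto (fun i => ∫ t in (0 : ℝ)..N, evolve (B i) (M i) t) l
      (𝓝 (∫ t in (0 : ℝ)..N, evolve B' M' t)) := by
  have h1 := (continuous_integral_evolve (H := H) N).tendsto (B', M')
  have h2 : Tendsto (fun i => (B i, M i)) l (𝓝 (B', M')) := hB.prodMk_nhds hM
  have h3 := h1.comp h2
  beta_reduce at h3
  simp only [Function.comp_def] at h3
  exact h3

/-- For `l ≠ 0` the eigenspace is trivial; for `l = 0` it is the kernel itself. -/
theorem starProjection_ker_orthogonal_mem {B₀ : H →L[ℂ] H}
    (hspec : ∀ z : ℂ, z ≠ 0 → ¬ Module.End.HasEigenvalue (B₀ : H →ₗ[ℂ] H) z) (x : H) (l : ℝ) :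
    B₀.kerᗮ.starProjection x ∈ (B₀ - algebraMap ℝ (H →L[ℂ] H) l).kerᗮ := by
  have hx : B₀.kerᗮ.starProjection x ∈ B₀.kerᗮ := Submodule.starProjection_apply_mem _ x
  rw [Submodule.mem_orthogonal]
  intro m hm
  have hm' : B₀ m = (l : ℂ) • m := by
    have : B₀ m - l • m = 0 := by simpa [Algebra.algebraMap_eq_smul_one] using hm
    rw [sub_eq_zero.1 this]
    rfl
  by_cases hl : l = 0
  · refine (Submodule.mem_orthogonal _ _).1 hx m ?_
    simpa [hl] using hm'
  · have h0 : m = 0 := by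
      by_contra hne
      exact hspec l (by exact_mod_cast hl)
        (Module.End.hasEigenvalue_of_hasEigenvector
          ⟨Module.End.mem_eigenspace_iff.2 hm', hne⟩)
    rw [h0, inner_zero_left]

theorem tendsto_inverse_mul_mul_contProj {B₀ : H →L[ℂ] H} {ι : Type*} {l : Filter ι}
    {L : ι → H →L[ℂ] H} (hL : Tendsto L l (𝓝 1)) (hsa : ∀ᶠ ε in l, IsSelfAdjoint (L ε))
    (h1 : ∀ᶠ ε in l, 1 ≤ L ε) (K : H →L[ℂ] H) :
    Tendsto (fun ε => (L ε).inverse * K * contProj B₀ (L ε)) l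
      (𝓝 (K * B₀.kerᗮ.starProjection)) := by
  have hproj : Tendsto (fun ε => contProj B₀ (L ε)) l (𝓝 B₀.kerᗮ.starProjection) := by
    rw [tendsto_iff_norm_sub_tendsto_zero]
    refine squeeze_zero' (Eventually.of_forall fun _ => norm_nonneg _) ?_
      (tendsto_iff_norm_sub_tendsto_zero.1 hL)
    filter_upwards [hsa, h1] with ε h2 h3 using norm_contProj_sub_le B₀ h2 h3
  have hinv : Tendsto (fun ε => (L ε).inverse) l (𝓝 1) := by
    have h := NormedRing.inverse_continuousAt (1 : (H →L[ℂ] H)ˣ)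
    rw [ContinuousAt, Units.val_one, Ring.inverse_one] at h
    refine (h.comp hL).congr fun ε => ?_
    rw [Function.comp_apply, ContinuousLinearMap.ringInverse_eq_inverse]
  have h := (hinv.mul_const K).mul hproj
  rwa [one_mul] at h

/-- This is the limit of the bound in `norm_timeAverage_le`. There `a₀` is `‖1‖`, which is only at
most 1 if the space may be trivial. -/
theorem eventually_mul_add_mul_lt {ι : Type*} {l : Filter ι} {a q m e : ι → ℝ} {a₀ q₀ m₀ N δ : ℝ}
    (ha : Tendsto a l (𝓝 a₀)) (hq : Tendsto q l (𝓝 q₀)) (hm : Tendsto m l (𝓝 m₀))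
    (he : Tendsto e l (𝓝 0)) (ha₀ : a₀ ≤ 1) (hq₀ : 0 ≤ q₀) (hδ : q₀ < δ) :
    ∀ᶠ i in l, a i * q i + a i * m i * N * e i < δ := by
  have h := (ha.mul hq).add (((ha.mul hm).mul_const N).mul he)
  rw [mul_zero, add_zero] at h
  exact h.eventually_lt_const ((mul_le_of_le_one_left hq₀ ha₀).trans_lt hδ)

theorem tendsto_norm_timeAverage {B₀ : H →L[ℂ] H} (hB₀ : IsSelfAdjoint B₀)
    (hspec : ∀ z : ℂ, z ≠ 0 → ¬ Module.End.HasEigenvalue (B₀ : H →ₗ[ℂ] H) z)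
    {L : ℝ → H →L[ℂ] H} (hL : Tendsto L (𝓝[>] 0) (𝓝 1))
    (hsa : ∀ᶠ ε in 𝓝[>] (0 : ℝ), IsSelfAdjoint (L ε)) (h1 : ∀ᶠ ε in 𝓝[>] (0 : ℝ), 1 ≤ L ε)
    {K : H →L[ℂ] H} (hK : IsCompactOperator K) {T : ℝ} (hT : 0 < T) :
    Tendsto (fun ε => ‖timeAverage B₀ (L ε) K T ε‖) (𝓝[>] 0) (𝓝 0) := by
  have hmean : MeanNull B₀ (K * B₀.kerᗮ.starProjection) := meanNull_of_isCompactOperator hB₀ hK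
    (isSelfAdjoint_starProjection _) (Submodule.starProjection_norm_le _)
    (starProjection_ker_orthogonal_mem hspec)
  have hM := tendsto_inverse_mul_mul_contProj (B₀ := B₀) hL hsa h1 K
  have hB : Tendsto (fun ε => B₀ ∘L L ε) (𝓝[>] 0) (𝓝 B₀) := by
    have h := hL.const_mul B₀
    rwa [mul_one] at h
  have hid : Tendsto (fun ε : ℝ => ε / T) (𝓝[>] 0) (𝓝 0) := by
    have h : Tendsto (fun ε : ℝ => ε / T) (𝓝 0) (𝓝 (0 / T)) := tendsto_id.div_const T
    rw [zero_div] at h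
    exact h.mono_left nhdsWithin_le_nhds
  refine tendsto_order.2 ⟨fun δ hδ => Eventually.of_forall fun _ => hδ.trans_le (norm_nonneg _),
    fun δ hδ => ?_⟩
  -- RAGE for `B₀` fixes `N` before `ε` moves; at this `N` the perturbed mean converges to the
  -- unperturbed one.
  obtain ⟨N, hNδ, hN⟩ := ((hmean.eventually_lt_const hδ).and (eventually_gt_atTop 0)).exists
  have hint : Tendsto (fun ε => ∫ t in (0 : ℝ)..N,
      evolve (B₀ ∘L L ε) ((L ε).inverse * K * contProj B₀ (L ε)) t) (𝓝[>] 0)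
      (𝓝 (∫ t in (0 : ℝ)..N, evolve B₀ (K * B₀.kerᗮ.starProjection) t)) :=
    tendsto_integral_evolve hB hM N
  filter_upwards [eventually_mul_add_mul_lt (N := N) hL.norm (hint.norm.const_mul N⁻¹) hM.norm hid
    ContinuousLinearMap.norm_id_le (by positivity) hNδ, hsa, h1, self_mem_nhdsWithin]
    with ε hb h2 h3 hε
  exact (norm_timeAverage_le hB₀ h2 h3 K hT hε hN).trans_lt hb

theorem tendsto_metricOpNorm_timeAverage {B₀ : H →L[ℂ] H} (hB₀ : IsSelfAdjoint B₀)
    (hspec : ∀ z : ℂ, z ≠ 0 → ¬ Module.End.HasEigenvalue (B₀ : H →ₗ[ℂ] H) z)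
    {L : ℝ → H →L[ℂ] H} (hL : Tendsto L (𝓝[>] 0) (𝓝 1))
    (hsa : ∀ᶠ ε in 𝓝[>] (0 : ℝ), IsSelfAdjoint (L ε)) (h1 : ∀ᶠ ε in 𝓝[>] (0 : ℝ), 1 ≤ L ε)
    {K : H →L[ℂ] H} (hK : IsCompactOperator K) {T : ℝ} (hT : 0 < T) :
    Tendsto (fun ε => metricOpNorm (L ε) (timeAverage B₀ (L ε) K T ε)) (𝓝[>] 0) (𝓝 0) := by
  have h := hL.norm.sqrt.mul (tendsto_norm_timeAverage hB₀ hspec hL hsa h1 hK hT)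
  rw [mul_zero] at h
  refine squeeze_zero' (Eventually.of_forall fun _ => metricOpNorm_nonneg _ _) ?_ h
  filter_upwards [h1] with ε h3 using metricOpNorm_le h3 _

end LongTime

end RageParam

theorem mainTheorem3 {H : Type*} [NormedAddCommGroup H] [InnerProductSpace ℂ H] [CompleteSpace H]
    (B₀ : H →L[ℂ] H) (hB₀ : IsSelfAdjoint B₀)
    (Λ : ℝ → H →L[ℂ] H)
    (hΛan : AnalyticOn ℝ Λ (Set.Icc 0 1))
    (hΛ0 : Λ 0 = ContinuousLinearMap.id ℂ H)
    (hΛsa : ∀ η ∈ Set.Icc (0 : ℝ) 1, IsSelfAdjoint (Λ η))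
    (hΛmono : ∀ η₁ η₂ : ℝ, 0 ≤ η₁ → η₁ ≤ η₂ → η₂ ≤ 1 → Λ η₁ ≤ Λ η₂)
    (hspec : ∀ η ∈ Set.Icc (0 : ℝ) 1, RageParam.pointSpectrum (B₀ ∘L Λ η) = {0})
    (σ : ℝ → ℝ) (hσmaps : Set.MapsTo σ (Set.Icc 0 1) (Set.Icc 0 1))
    (hσcont : ContinuousOn σ (Set.Icc 0 1)) (hσmono : MonotoneOn σ (Set.Icc 0 1))
    (hσ0 : σ 0 = 0) (hσ1 : σ 1 = 1)
    (K : H →L[ℂ] H) (hK : IsCompactOperator K) (T : ℝ) (hT : 0 < T) :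
    Filter.Tendsto
      (fun ε : ℝ =>
        RageParam.metricOpNorm (Λ (σ ε)) (RageParam.timeAverage B₀ (Λ (σ ε)) K T ε))
      (nhdsWithin 0 (Set.Ioi 0)) (nhds 0) := by
  have h0 : (0 : ℝ) ∈ Set.Icc (0 : ℝ) 1 := ⟨le_rfl, zero_le_one⟩
  -- `σ` and `Λ` are controlled on `[0, 1]` only, so the limit is restricted to `ε` in that
  -- interval.
  have hev : ∀ᶠ ε in nhdsWithin (0 : ℝ) (Set.Ioi 0), ε ∈ Set.Icc (0 : ℝ) 1 := by
    filter_upwards [Ioc_mem_nhdsGT (zero_lt_one (α := ℝ))] with ε hε using ⟨hε.1.le, hε.2⟩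
  have hlim : Filter.Tendsto (fun ε => Λ (σ ε)) (nhdsWithin 0 (Set.Ioi 0)) (nhds 1) := by
    have h := (hΛan.continuousOn.comp hσcont hσmaps) 0 h0
    rw [ContinuousWithinAt, Function.comp_apply, hσ0, hΛ0] at h
    exact h.mono_left (le_inf nhdsWithin_le_nhds (Filter.le_principal_iff.2 hev))
  refine RageParam.tendsto_metricOpNorm_timeAverage hB₀ (fun z hz hev => hz ?_) hlim
    (hev.mono fun ε hε => hΛsa _ (hσmaps hε)) (hev.mono fun ε hε => ?_) hK hT
  · have h := hspec 0 h0
    rw [hΛ0, ContinuousLinearMap.comp_id] at h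
    exact h.subset hev
  -- Monotonicity from `Λ 0 = 1` gives the lower bound `1 ≤ Λ (σ ε)`.
  · have h := hΛmono 0 (σ ε) le_rfl (hσmaps hε).1 (hσmaps hε).2
    rwa [hΛ0] at h
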